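/- All graphs are finite, simple and connected. A graph $G$ is called locally linear if, for every vertex $v$ of $G$, the subgraph of $G$ induced by the set of neighbours of $v$ is a path (with at least one vertex). A graph is hamiltonian if it contains a cycle through all of its vertices, and nonhamiltonian otherwise. Theorem: among the locally linear graphs with at least three vertices, the minimum order (number of vertices) of a nonhamiltonian one is $12$. That is, every locally linear graph with at least $3$ and at most $11$ vertices is hamiltonian, and there exists a nonhamiltonian locally linear graph with exactly $12$ vertices. -/

import Mathlib

/-- A graph is a path if it is isomorphic to the path graph on `k + 1` vertices for some `k`
(so a path has at least one vertex). -/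
def IsPathGraph {V : Type*} (G : SimpleGraph V) : Prop :=
  ∃ k : ℕ, Nonempty (G ≃g SimpleGraph.pathGraph (k + 1))

/-- A locally linear graph: a connected graph in which the subgraph induced by the neighbourhood
of every vertex is a path. -/
def IsLocallyLinear {V : Type*} (G : SimpleGraph V) : Prop :=
  G.Connected ∧ ∀ v : V, IsPathGraph (G.induce (G.neighborSet v))

/-! With at least three vertices every link is a path on at least two vertices. So an edge lies in
one or two triangles, and exactly two edges at each vertex lie in one, namely those to the ends of
its link. These edges form `rimGraph`, a spanning disjoint union of cycles, the rims. A single rim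
is a Hamiltonian cycle. A triangular rim is the whole graph (`eq_of_rim_triangle`), so if there are
several rims each has length at least 4, and three of them need 12 vertices.

Two rims merge into a Hamiltonian cycle if rim edges aa' and bb', one on each, can be exchanged for
edges ab and a'b' of the graph (`isHamiltonian_of_swap`). For two rims on at most 11 vertices there
are six pairs of lengths, and a search evaluated by the kernel shows that such an exchange always
exists. It starts from the two cycles and one edge between them and branches over the third vertex
of a missing triangle. It discards partial graphs with too many triangles on an edge, a disconnected
link or an exchange. `Unmergeable.not_refute` is its soundness.

Order 12 is attained by `earedAntiprism`, whose rims have lengths 4 and 8: its four ears occupy all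
passages of a Hamiltonian cycle through the outer square, so the inner square cannot be joined to
the rest. -/

namespace TwoRims

/-! ### Boolean search, written with recursors and binary arithmetic so that the kernel evaluates it
quickly -/

/-- Conjunction. -/
def both (a b : Bool) : Bool := Bool.rec false b a

/-- Disjunction. -/
def either (a b : Bool) : Bool := Bool.rec b true a

/-- Negation. -/
def neg (a : Bool) : Bool := Bool.rec true false a

/-- Bounded universal quantification. -/
def allBelow (f : ℕ → Bool) (n : ℕ) : Bool :=
  Nat.rec true (fun k ih => Bool.rec false ih (f k)) n

/-- The number of binary digits `1` of `c` at positions below `n`. -/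
def countBits (c n : ℕ) : ℕ :=
  Nat.rec 0 (fun k ih => Nat.add ih (Nat.land (Nat.shiftRight c k) 1)) n

/-- The successor in the disjoint union of the cycles `0, …, p - 1` and `p, …, p + q - 1`. -/
def next (p q i : ℕ) : ℕ :=
  Bool.rec (Nat.mod (Nat.succ i) p) (Nat.add p (Nat.mod (Nat.succ (Nat.sub i p)) q)) (Nat.ble p i)

/-- The predecessor in the disjoint union of the cycles `0, …, p - 1` and `p, …, p + q - 1`. -/
def prev (p q i : ℕ) : ℕ :=
  Bool.rec (Nat.mod (Nat.add i (Nat.sub p 1)) p)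
    (Nat.add p (Nat.mod (Nat.add (Nat.sub i p) (Nat.sub q 1)) q)) (Nat.ble p i)

/-- Adjacency in the disjoint union of the two cycles. -/
def rim (p q i j : ℕ) : Bool := either (Nat.beq (next p q i) j) (Nat.beq (next p q j) i)

/-- The number of triangles on an edge. -/
def cap (p q i j : ℕ) : ℕ := Bool.rec 2 1 (rim p q i j)

/-- A partial graph on at most 16 vertices is stored as one number: row `u` of its adjacency
matrix occupies the binary digits from `16 * u` to `16 * u + 15`. -/
def row (E u : ℕ) : ℕ := Nat.land (Nat.shiftRight E (Nat.mul 16 u)) 65535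

/-- The binary digit of `r` at position `v`. -/
def bit (r v : ℕ) : Bool := Nat.beq (Nat.land (Nat.shiftRight r v) 1) 1

/-- Insertion of the edge `ab`. -/
def addEdge (E a b : ℕ) : ℕ :=
  Nat.lor E (Nat.lor (Nat.shiftLeft 1 (Nat.add (Nat.mul 16 a) b))
    (Nat.shiftLeft 1 (Nat.add (Nat.mul 16 b) a)))

/-- The set of vertices met on a walk from `w` in the graph `E` induced on the set `r`. -/
def walkLink (E r k : ℕ) : ℕ → ℕ → ℕ :=
  Nat.rec (fun _ S => S) (fun _ ih w S =>
    (fun d => Bool.rec (ih (Nat.log2 d) (Nat.lor S (Nat.shiftLeft 1 (Nat.log2 d)))) S (Nat.beq d 0))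
      ((fun c => Nat.xor c (Nat.land c S)) (Nat.land r (row E w)))) k

/-- `S` is a nonempty proper subset of the neighbours of `v`, and the edges from `v` to `S` have
reached their number of triangles inside `S`. -/
def closedOff (p q E v S : ℕ) : Bool :=
  both (neg (Nat.beq (Nat.land (row E v) S) (row E v)))
    (both (Nat.beq (Nat.land S (row E v)) S)
      (both (neg (Nat.beq S 0))
        (allBelow (fun x => either (neg (bit S x))
          (Nat.beq (countBits (Nat.land (Nat.land (row E v) (row E x)) S) (Nat.add p q))
            (cap p q v x))) 16)))

/-- No subset of the neighbours of `v` is closed off. -/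
def openLink (p q E v : ℕ) : Bool :=
  neg (closedOff p q E v
    -- The edge from `v` to `next p q v` is a rim edge, so the walk starts at an end of the link.
    -- The bound 12 exceeds the size of any link on at most 11 vertices.
    (walkLink E (row E v) 12 (next p q v) (Nat.shiftLeft 1 (next p q v))))

/-- If `ab` joins the two cycles, then no neighbour of `a` on its cycle is adjacent to a neighbour
of `b` on its cycle. -/
def swapFree (p q E a b : ℕ) : Bool :=
  -- This first alternative is true exactly when `a` and `b` lie on the same cycle.
  either (Bool.rec (neg (Nat.ble p a)) (Nat.ble p a) (Nat.ble p b))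
    (both
      (both (neg (bit (row E (next p q a)) (next p q b)))
        (neg (bit (row E (next p q a)) (prev p q b))))
      (both (neg (bit (row E (prev p q a)) (next p q b)))
        (neg (bit (row E (prev p q a)) (prev p q b)))))

/-- The edge `uv` is not in too many triangles. -/
def capped (p q E u v : ℕ) : Bool :=
  either (neg (bit (row E u) v))
    (Nat.ble (countBits (Nat.land (row E u) (row E v)) (Nat.add p q)) (cap p q u v))

/-- The partial graph passes all tests around its triangle `uvx`. -/
def consistent (p q E u v x : ℕ) : Bool :=
  both (both (swapFree p q E u x) (swapFree p q E v x))
    (both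
      (allBelow (fun w => both (capped p q E u w) (both (capped p q E v w) (capped p q E x w)))
        (Nat.add p q))
      (both (openLink p q E u) (both (openLink p q E v) (openLink p q E x))))

/-- The edge `uv` is not yet in enough triangles. -/
def deficient (p q E u v : ℕ) : Bool :=
  both (bit (row E u) v)
    (Nat.ble (Nat.succ (countBits (Nat.land (row E u) (row E v)) (Nat.add p q))) (cap p q u v))

/-- Search for a contradiction, branching over the missing triangle on a deficient edge. -/
def refute (p q k : ℕ) : ℕ → Bool :=
  Nat.rec (fun _ => false) (fun _ ih E =>
    -- The two outer negations encode existence: it suffices that one deficient edge has only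
    -- failing completions.
    neg (allBelow (fun u => allBelow (fun v =>
      either (neg (deficient p q E u v))
        (neg (allBelow (fun x => either (bit (Nat.land (row E u) (row E v)) x)
          (either (Nat.beq x u) (either (Nat.beq x v)
            (either (neg (consistent p q (addEdge (addEdge E u x) v x) u v x))
              (ih (addEdge (addEdge E u x) v x)))))) (Nat.add p q)))) u) (Nat.add p q))) k

/-- The first `k` edges of the two cycles, and an edge between the cycles. -/
def rimEdges (p q k : ℕ) : ℕ :=
  Nat.rec (addEdge 0 0 p) (fun k ih => addEdge ih k (next p q k)) k

/-! ### Soundness -/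

/-- A graph on `0, …, p + q - 1` that contains the two cycles, in which an edge is in one or
two triangles according to whether it is on the cycles or not, with connected links, and such that
the two cycles cannot be merged by exchanging two edges. -/
structure Unmergeable (p q : ℕ) (adj : ℕ → ℕ → Prop) : Prop where
  symm : ∀ {u v}, adj u v → adj v u
  irrefl : ∀ {u}, ¬ adj u u
  lt : ∀ {u v}, adj u v → v < p + q
  card_common : ∀ {u v}, adj u v → {x | adj u x ∧ adj v x}.ncard = cap p q u v
  link : ∀ {v} {S : ℕ → Prop}, (∃ x, S x ∧ adj v x) →
    (∀ x y, S x → adj v x → adj v y → adj x y → S y) → ∀ y, adj v y → S y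
  noSwap : ∀ {a b a' b'}, a < p → p ≤ b → adj a b → rim p q a a' → rim p q b b' → ¬ adj a' b'

@[simp] theorem both_eq (a b : Bool) : both a b = (a && b) := by cases a <;> rfl
@[simp] theorem either_eq (a b : Bool) : either a b = (a || b) := by cases a <;> rfl
@[simp] theorem neg_eq (a : Bool) : neg a = !a := by cases a <;> rfl

theorem beq_iff {a b : ℕ} : Nat.beq a b = true ↔ a = b := by rw [Nat.beq_eq]

theorem allBelow_iff {f : ℕ → Bool} {n : ℕ} : allBelow f n = true ↔ ∀ k < n, f k = true := by
  induction n with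
  | zero => simp [allBelow]
  | succ n ih =>
    have : allBelow f (n + 1) = (f n && allBelow f n) := by
      show (Bool.rec false (allBelow f n) (f n) : Bool) = _
      cases f n <;> rfl
    rw [this, Bool.and_eq_true, ih]
    constructor
    · rintro ⟨h, h'⟩ k hk
      rcases Nat.lt_succ_iff_lt_or_eq.1 hk with hk | rfl
      exacts [h' k hk, h]
    · exact fun h => ⟨h n (by omega), fun k hk => h k (by omega)⟩

theorem bit_eq_testBit (r v : ℕ) : bit r v = r.testBit v := by
  have h : bit r v = Nat.beq ((r >>> v) &&& 1) 1 := rfl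
  rw [h, Nat.and_one_is_mod, Nat.testBit_eq_decide_div_mod_eq, Nat.shiftRight_eq_div_pow]
  rw [Bool.eq_iff_iff, beq_iff]
  simp

theorem bit_row (E u v : ℕ) : bit (row E u) v = (E.testBit (16 * u + v) && decide (v < 16)) := by
  have h : row E u = (E >>> (16 * u)) &&& 65535 := rfl
  rw [bit_eq_testBit, h, Nat.testBit_and, Nat.testBit_shiftRight,
    show 65535 = 2 ^ 16 - 1 from rfl, Nat.testBit_two_pow_sub_one]

theorem bit_land (r s v : ℕ) : bit (Nat.land r s) v = (bit r v && bit s v) := by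
  simp only [bit_eq_testBit]
  exact Nat.testBit_and r s v

theorem bit_row_addEdge {E a b u v : ℕ} (ha : a < 16) (hb : b < 16)
    (h : bit (row (addEdge E a b) u) v = true) :
    bit (row E u) v = true ∨ (u = a ∧ v = b) ∨ (u = b ∧ v = a) := by
  rw [bit_row] at h ⊢
  have h' : addEdge E a b = E ||| (1 <<< (16 * a + b) ||| 1 <<< (16 * b + a)) := rfl
  simp only [h', Nat.testBit_or, Nat.one_shiftLeft, Nat.testBit_two_pow, Bool.and_eq_true,
    Bool.or_eq_true, decide_eq_true_eq] at h ⊢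
  obtain ⟨h | h | h, hv⟩ := h
  · exact .inl ⟨h, hv⟩
  · exact .inr (.inl (by omega))
  · exact .inr (.inr (by omega))

theorem countBits_eq (c n : ℕ) : countBits c n = {x | x < n ∧ bit c x = true}.ncard := by
  induction n with
  | zero => simp [countBits]
  | succ n ih =>
    have h : countBits c (n + 1) = countBits c n + ((c >>> n) &&& 1) := rfl
    have hfin : {x | x < n ∧ bit c x = true}.Finite :=
      (Set.finite_lt_nat n).subset fun x hx => hx.1
    have hb : bit c n = Nat.beq ((c >>> n) &&& 1) 1 := rfl
    rw [h, ih]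
    have h1 : (c >>> n) &&& 1 = 0 ∨ (c >>> n) &&& 1 = 1 := by
      rw [Nat.and_one_is_mod]; omega
    rcases h1 with h1 | h1
    · rw [h1, Nat.add_zero]
      congr 1
      ext x
      rw [h1] at hb
      simp only [Set.mem_ofPred_eq]
      constructor
      · exact fun hx => ⟨by omega, hx.2⟩
      · rintro ⟨hx, hx'⟩
        rcases Nat.lt_succ_iff_lt_or_eq.1 hx with hx | rfl
        · exact ⟨hx, hx'⟩
        · rw [hb] at hx'; cases hx'
    · rw [h1, ← Set.ncard_insert_of_notMem (a := n) (by simp) hfin]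
      congr 1
      ext x
      rw [h1] at hb
      simp only [Set.mem_ofPred_eq, Set.mem_insert_iff]
      constructor
      · rintro (rfl | hx)
        · exact ⟨by omega, hb⟩
        · exact ⟨by omega, hx.2⟩
      · rintro ⟨hx, hx'⟩
        rcases Nat.lt_succ_iff_lt_or_eq.1 hx with hx | rfl
        · exact .inr ⟨hx, hx'⟩
        · exact .inl rfl

theorem next_of_lt {p q i : ℕ} (h : i < p) : next p q i = (i + 1) % p := by
  have : Nat.ble p i = false := by rw [← Bool.not_eq_true, Nat.ble_eq]; omega
  rw [next, this]; rfl

theorem next_of_le {p q i : ℕ} (h : p ≤ i) : next p q i = p + (i - p + 1) % q := by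
  have : Nat.ble p i = true := by rwa [Nat.ble_eq]
  rw [next, this]; rfl

theorem next_prev {p q i : ℕ} (h : i < p + q) : next p q (prev p q i) = i := by
  rcases lt_or_ge i p with hi | hi
  · have h1 : Nat.ble p i = false := by rw [← Bool.not_eq_true, Nat.ble_eq]; omega
    have h2 : prev p q i = (i + (p - 1)) % p := by rw [prev, h1]; rfl
    rw [h2, next_of_lt (Nat.mod_lt _ (by omega)), Nat.mod_add_mod,
      show i + (p - 1) + 1 = i + p by omega, Nat.add_mod_right, Nat.mod_eq_of_lt hi]
  · have h1 : Nat.ble p i = true := by rwa [Nat.ble_eq]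
    have h2 : prev p q i = p + (i - p + (q - 1)) % q := by rw [prev, h1]; rfl
    rw [h2, next_of_le (by omega), Nat.add_sub_cancel_left, Nat.mod_add_mod,
      show i - p + (q - 1) + 1 = i - p + q by omega, Nat.add_mod_right,
      Nat.mod_eq_of_lt (by omega)]
    omega

theorem rim_iff {p q i j : ℕ} : rim p q i j = true ↔ next p q i = j ∨ next p q j = i := by
  simp [rim]

theorem rim_next (p q i : ℕ) : rim p q i (next p q i) := rim_iff.2 (.inl rfl)

theorem rim_prev {p q i : ℕ} (h : i < p + q) : rim p q i (prev p q i) :=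
  rim_iff.2 (.inr (next_prev h))

namespace Unmergeable

variable {p q : ℕ} {adj : ℕ → ℕ → Prop}

theorem finite_common (h : Unmergeable p q adj) (u v : ℕ) : {x | adj u x ∧ adj v x}.Finite :=
  (Set.finite_lt_nat (p + q)).subset fun _ hx => h.lt hx.1

theorem countBits_le (h : Unmergeable p q adj) {E : ℕ}
    (hE : ∀ u v, bit (row E u) v = true → adj u v) {u v : ℕ} (huv : adj u v) :
    countBits (Nat.land (row E u) (row E v)) (Nat.add p q) ≤ cap p q u v := by
  rw [countBits_eq, ← h.card_common huv]
  refine Set.ncard_le_ncard (fun x hx => ?_) (h.finite_common u v)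
  have := hx.2
  rw [bit_land, Bool.and_eq_true] at this
  exact ⟨hE _ _ this.1, hE _ _ this.2⟩

theorem capped (h : Unmergeable p q adj) {E : ℕ}
    (hE : ∀ u v, bit (row E u) v = true → adj u v) (u v : ℕ) : capped p q E u v = true := by
  rw [TwoRims.capped, either_eq, neg_eq]
  by_cases huv : bit (row E u) v = true
  · simp only [huv, Bool.not_true, Bool.false_or, Nat.ble_eq]
    exact h.countBits_le hE (hE _ _ huv)
  · simp [huv]

theorem swapFree (h : Unmergeable p q adj) {E : ℕ}
    (hE : ∀ u v, bit (row E u) v = true → adj u v) {a b : ℕ} (hab : adj a b) :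
    swapFree p q E a b = true := by
  have key : ∀ a' b', rim p q a a' → rim p q b b' →
      (Bool.rec (neg (Nat.ble p a)) (Nat.ble p a) (Nat.ble p b) : Bool) = false →
      bit (row E a') b' = false := by
    intro a' b' ha' hb' hs
    rw [← Bool.not_eq_true]
    intro hbit
    have := hE _ _ hbit
    rcases hpa : Nat.ble p a with _ | _ <;> rcases hpb : Nat.ble p b with _ | _ <;>
      rw [hpa, hpb] at hs
    · simp at hs
    · rw [← Bool.not_eq_true, Nat.ble_eq] at hpa
      rw [Nat.ble_eq] at hpb
      exact h.noSwap (not_le.1 hpa) hpb hab ha' hb' this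
    · rw [← Bool.not_eq_true, Nat.ble_eq] at hpb
      rw [Nat.ble_eq] at hpa
      exact h.noSwap (not_le.1 hpb) hpa (h.symm hab) hb' ha' (h.symm this)
    · simp at hs
  have ha := h.lt (h.symm hab)
  have hb := h.lt hab
  rw [TwoRims.swapFree, either_eq]
  rcases hs : (Bool.rec (neg (Nat.ble p a)) (Nat.ble p a) (Nat.ble p b) : Bool) with _ | _
  · simp [key _ _ (rim_next p q a) (rim_next p q b) hs, key _ _ (rim_next p q a) (rim_prev hb) hs,
      key _ _ (rim_prev ha) (rim_next p q b) hs, key _ _ (rim_prev ha) (rim_prev hb) hs]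
  · rw [hs, Bool.true_or]

/-- A closed off set would be a union of components of the link of `v` without being all of it,
contradicting connectedness. Since `S` is arbitrary, nothing needs to be proved about `walkLink`. -/
theorem not_closedOff (h : Unmergeable p q adj) (hpq : p + q ≤ 16) {E : ℕ}
    (hE : ∀ u v, bit (row E u) v = true → adj u v) (v S : ℕ) :
    ¬ closedOff p q E v S = true := by
  intro hc
  simp only [closedOff, both_eq, neg_eq, either_eq, Bool.and_eq_true, Bool.not_eq_true',
    Bool.or_eq_true, allBelow_iff, beq_iff] at hc
  obtain ⟨h1, h2, h3, h4⟩ := hc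
  have hS : ∀ x, bit S x = true → bit (row E v) x = true := by
    intro x hx
    rw [← h2, bit_land, Bool.and_eq_true] at hx
    exact hx.2
  have hclosed : ∀ x y, bit S x = true → adj v x → adj v y → adj x y → bit S y = true := by
    intro x y hx hvx hvy hxy
    have h5 := h4 x ((h.lt hvx).trans_le hpq)
    simp only [hx, Bool.true_eq_false, false_or] at h5
    rw [countBits_eq, ← h.card_common hvx] at h5
    have hsub : {z | z < Nat.add p q ∧
        bit (Nat.land (Nat.land (row E v) (row E x)) S) z = true} ⊆ {z | adj v z ∧ adj x z} := by
      rintro z ⟨-, hz⟩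
      rw [bit_land, bit_land, Bool.and_eq_true, Bool.and_eq_true] at hz
      exact ⟨hE _ _ hz.1.1, hE _ _ hz.1.2⟩
    -- The common neighbours found inside `S` already attain the true number, so there are no
    -- others.
    have heq := Set.eq_of_subset_of_ncard_le hsub h5.ge (h.finite_common v x)
    have : y ∈ {z | adj v z ∧ adj x z} := ⟨hvy, hxy⟩
    rw [← heq] at this
    have := this.2
    rw [bit_land, Bool.and_eq_true] at this
    exact this.2
  have hne : ∃ x, bit S x = true ∧ adj v x := by
    by_contra! hno
    have : S = 0 := by
      refine Nat.eq_of_testBit_eq fun x => ?_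
      rw [← bit_eq_testBit, Nat.zero_testBit, ← Bool.not_eq_true]
      exact fun hx => hno x hx (hE _ _ (hS x hx))
    subst this
    simp at h3
  have hall := h.link hne hclosed
  have : Nat.land (row E v) S = row E v := by
    refine Nat.eq_of_testBit_eq fun x => ?_
    rw [← bit_eq_testBit, ← bit_eq_testBit, bit_land]
    by_cases hx : bit (row E v) x = true
    · rw [hx, hall x (hE _ _ hx)]; rfl
    · simp [hx]
  rw [this, ← Bool.not_eq_true, beq_iff] at h1
  exact h1 rfl

theorem openLink (h : Unmergeable p q adj) (hpq : p + q ≤ 16) {E : ℕ}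
    (hE : ∀ u v, bit (row E u) v = true → adj u v) (v : ℕ) : openLink p q E v = true := by
  have := h.not_closedOff hpq hE v
    (walkLink E (row E v) 12 (next p q v) (Nat.shiftLeft 1 (next p q v)))
  rw [TwoRims.openLink, neg_eq]
  simpa using this

/-- A deficient edge of a subgraph has a further common neighbour `x` in the true graph. Adding that
triangle gives a larger subgraph of the true graph, which passes every test, so the branch of `x` is
never refuted. -/
theorem not_refute (h : Unmergeable p q adj) (hpq : p + q ≤ 16) (k : ℕ) :
    ∀ E : ℕ, (∀ u v, bit (row E u) v = true → adj u v) → ¬ refute p q k E = true := by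
  induction k with
  | zero => intro E _ hr; cases hr
  | succ k ih =>
    intro E hE hr
    have hr' : neg (allBelow (fun u => allBelow (fun v =>
      either (neg (deficient p q E u v))
        (neg (allBelow (fun x => either (bit (Nat.land (row E u) (row E v)) x)
          (either (Nat.beq x u) (either (Nat.beq x v)
            (either (neg (consistent p q (addEdge (addEdge E u x) v x) u v x))
              (refute p q k (addEdge (addEdge E u x) v x)))))) (Nat.add p q)))) u)
      (Nat.add p q)) = true := hr
    rw [neg_eq, Bool.not_eq_true', ← Bool.not_eq_true] at hr'
    refine hr' (allBelow_iff.2 fun u hu => allBelow_iff.2 fun v hv => ?_)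
    rw [either_eq, neg_eq, neg_eq, Bool.or_eq_true, Bool.not_eq_true', Bool.not_eq_true',
      ← Bool.not_eq_true, ← Bool.not_eq_true, ← not_and_or]
    rintro ⟨hdef, hx⟩
    simp only [deficient, both_eq, Bool.and_eq_true, Nat.ble_eq] at hdef
    have huv := hE _ _ hdef.1
    have hlt := hdef.2
    rw [Nat.succ_le_iff, countBits_eq, ← h.card_common huv] at hlt
    obtain ⟨x, ⟨hux, hvx⟩, hx'⟩ := Set.exists_mem_notMem_of_ncard_lt_ncard hlt
      ((Set.finite_lt_nat _).subset fun x hx => hx.1)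
    have hxn : x < Nat.add p q := h.lt hux
    have hn16 : ∀ {y z}, adj y z → z < 16 := fun hyz => (h.lt hyz).trans_le hpq
    have hE' : ∀ a b, bit (row (addEdge (addEdge E u x) v x) a) b = true → adj a b := by
      intro a b hab
      rcases bit_row_addEdge (hn16 huv) (hn16 hux) hab with hab | ⟨rfl, rfl⟩ | ⟨rfl, rfl⟩
      · rcases bit_row_addEdge (hn16 (h.symm huv)) (hn16 hux) hab with hab | ⟨rfl, rfl⟩ | ⟨rfl, rfl⟩
        exacts [hE _ _ hab, hux, h.symm hux]
      exacts [hvx, h.symm hvx]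
    have hcons : consistent p q (addEdge (addEdge E u x) v x) u v x = true := by
      simp only [consistent, both_eq, Bool.and_eq_true, allBelow_iff]
      exact ⟨⟨h.swapFree hE' hux, h.swapFree hE' hvx⟩,
        fun w _ => ⟨h.capped hE' _ _, h.capped hE' _ _, h.capped hE' _ _⟩,
        h.openLink hpq hE' _, h.openLink hpq hE' _, h.openLink hpq hE' _⟩
    have hx2 := allBelow_iff.1 hx x hxn
    simp only [either_eq, neg_eq, Bool.or_eq_true, beq_iff, hcons, Bool.not_true,
      Bool.false_eq_true, false_or] at hx2
    rcases hx2 with hx2 | rfl | rfl | hx2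
    · exact hx' ⟨hxn, hx2⟩
    · exact h.irrefl hux
    · exact h.irrefl hvx
    · exact ih _ hE' hx2

theorem not_refute_rimEdges (h : Unmergeable p q adj) (hpq : p + q ≤ 16) (k : ℕ)
    (hrim : ∀ i < p + q, adj i (next p q i)) (h0 : adj 0 p) :
    ¬ refute p q k (rimEdges p q (p + q)) = true := by
  refine h.not_refute hpq k _ ?_
  have hn16 : ∀ {y z}, adj y z → z < 16 := fun hyz => (h.lt hyz).trans_le hpq
  suffices ∀ m ≤ p + q, ∀ u v, bit (row (rimEdges p q m) u) v = true → adj u v from this _ le_rfl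
  intro m
  induction m with
  | zero =>
    intro _ u v huv
    rcases bit_row_addEdge (E := 0) (a := 0) (b := p) (by norm_num) (hn16 h0) huv with
      hab | ⟨rfl, rfl⟩ | ⟨rfl, rfl⟩
    · rw [bit_row] at hab; simp at hab
    exacts [h0, h.symm h0]
  | succ m ih =>
    intro hm u v huv
    have hadj := hrim m hm
    rcases bit_row_addEdge (E := rimEdges p q m) (a := m) (b := next p q m)
      (hn16 (h.symm hadj)) (hn16 hadj) huv with hab | ⟨rfl, rfl⟩ | ⟨rfl, rfl⟩
    exacts [ih (by omega) u v hab, hadj, h.symm hadj]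

end Unmergeable

/-- The six pairs are all those with 4 ≤ q ≤ p and p + q ≤ 11. -/
theorem refute_four_four : refute 4 4 12 (rimEdges 4 4 8) = true := by decide +kernel
theorem refute_five_four : refute 5 4 12 (rimEdges 5 4 9) = true := by decide +kernel
theorem refute_six_four : refute 6 4 12 (rimEdges 6 4 10) = true := by decide +kernel
theorem refute_five_five : refute 5 5 12 (rimEdges 5 5 10) = true := by decide +kernel
theorem refute_seven_four : refute 7 4 12 (rimEdges 7 4 11) = true := by decide +kernel
theorem refute_six_five : refute 6 5 12 (rimEdges 6 5 11) = true := by decide +kernel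

/-- Two cycles of length at least four with at most eleven vertices in total can be merged. -/
theorem Unmergeable.false_of_le {p q : ℕ} {adj : ℕ → ℕ → Prop} (h : Unmergeable p q adj)
    (hrim : ∀ i < p + q, adj i (next p q i)) (h0 : adj 0 p) (hq : 4 ≤ q) (hqp : q ≤ p)
    (hpq : p + q ≤ 11) : False := by
  have hno := h.not_refute_rimEdges (by omega) 12 hrim h0
  have hcases : (p = 4 ∧ q = 4) ∨ (p = 5 ∧ q = 4) ∨ (p = 6 ∧ q = 4) ∨ (p = 5 ∧ q = 5) ∨
      (p = 7 ∧ q = 4) ∨ (p = 6 ∧ q = 5) := by omega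
  rcases hcases with ⟨rfl, rfl⟩ | ⟨rfl, rfl⟩ | ⟨rfl, rfl⟩ | ⟨rfl, rfl⟩ | ⟨rfl, rfl⟩ | ⟨rfl, rfl⟩
  exacts [hno refute_four_four, hno refute_five_four, hno refute_six_four, hno refute_five_five,
    hno refute_seven_four, hno refute_six_five]
end TwoRims

/-! ### Rims as disjoint unions of cycles, and the merging of two cycles. -/

namespace SimpleGraph

variable {V : Type*} {G H : SimpleGraph V}

theorem Connected.of_closed (hG : G.Connected) {S : V → Prop} (hne : ∃ x, S x)
    (hS : ∀ x y, S x → G.Adj x y → S y) (y : V) : S y := by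
  obtain ⟨x, hx⟩ := hne
  obtain ⟨w⟩ := hG.preconnected x y
  induction w with
  | nil => exact hx
  | cons h _ ih => exact ih (hS _ _ hx h)

theorem pathGraph_ncard_neighborSet {k : ℕ} (hk : 1 ≤ k) (i : Fin (k + 1)) :
    ((pathGraph (k + 1)).neighborSet i).ncard = if i = 0 ∨ i = Fin.last k then 1 else 2 := by
  obtain ⟨i, hi⟩ := i
  split_ifs with h
  · rw [Set.ncard_eq_one]
    simp only [Fin.ext_iff, Fin.val_zero, Fin.val_last] at h
    refine ⟨if i = 0 then ⟨1, by omega⟩ else ⟨i - 1, by omega⟩, ?_⟩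
    ext ⟨j, hj⟩
    simp only [mem_neighborSet, pathGraph_adj, Set.mem_singleton_iff]
    split_ifs with h0 <;> simp only [Fin.ext_iff] <;> omega
  · rw [Set.ncard_eq_two]
    simp only [Fin.ext_iff, Fin.val_zero, Fin.val_last, not_or] at h
    refine ⟨⟨i - 1, by omega⟩, ⟨i + 1, by omega⟩, by simp only [ne_eq, Fin.ext_iff]; omega, ?_⟩
    ext ⟨j, hj⟩
    simp only [mem_neighborSet, pathGraph_adj, Set.mem_insert_iff, Set.mem_singleton_iff,
      Fin.ext_iff]
    omega

/-- The graph formed by the edges that lie in exactly one triangle. -/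
def rimGraph (G : SimpleGraph V) : SimpleGraph V where
  Adj u v := G.Adj u v ∧ {x | G.Adj u x ∧ G.Adj v x}.ncard = 1
  symm := ⟨fun u v h => ⟨h.1.symm, by simpa only [and_comm] using h.2⟩⟩
  loopless := ⟨fun _ h => h.1.ne rfl⟩

theorem rimGraph_le : G.rimGraph ≤ G := fun _ _ h => h.1

/-- A cycle through `a` in a disjoint union of cycles, with its edge `aa'` removed. -/
theorem IsCycles.exists_isPath [Finite V] (hH : H.IsCycles) {a a' : V} (h : H.Adj a a') :
    ∃ P : H.Walk a' a, P.IsPath ∧ ∀ x, x ∈ P.support ↔ H.Reachable a x := by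
  obtain ⟨c, hc, hsupp⟩ := hH.exists_cycle_toSubgraph_verts_eq_connectedComponentSupp
    (c := H.connectedComponentMk a) (v := a) rfl ⟨a', h⟩
  have hmem : ∀ x, x ∈ c.support ↔ H.Reachable a x := by
    intro x
    rw [← Walk.mem_verts_toSubgraph, hsupp, ConnectedComponent.mem_supp_iff,
      ConnectedComponent.eq]
    exact ⟨Reachable.symm, Reachable.symm⟩
  obtain ⟨d, hd, hdmem, hsnd⟩ : ∃ d : H.Walk a a, d.IsCycle ∧
      (∀ x, x ∈ d.support ↔ H.Reachable a x) ∧ d.snd = a' := by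
    obtain ⟨x, y, -, hxy⟩ := Set.ncard_eq_two.1 (hH ⟨a', h⟩)
    have h1 : c.snd ∈ H.neighborSet a := c.adj_snd hc.not_nil
    have h2 : c.penultimate ∈ H.neighborSet a := (c.adj_penultimate hc.not_nil).symm
    have h3 : a' ∈ H.neighborSet a := h
    have h4 := hc.snd_ne_penultimate
    rw [hxy] at h1 h2 h3
    -- The two distinct neighbours of `a` on the cycle exhaust its neighbourhood, so the cycle,
    -- reversed if necessary, begins with the edge `aa'`.
    have : c.snd = a' ∨ c.penultimate = a' := by grind
    rcases this with h5 | h5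
    · exact ⟨c, hc, hmem, h5⟩
    · exact ⟨c.reverse, hc.reverse, by simpa using hmem, by rw [Walk.snd_reverse, h5]⟩
  subst hsnd
  refine ⟨d.tail, hd.isPath_tail, fun x => ?_⟩
  rw [← hdmem, ← Walk.cons_support_tail hd.not_nil, List.mem_cons]
  refine ⟨.inr, ?_⟩
  rintro (rfl | hx)
  exacts [d.tail.end_mem_support, hx]

section Hamiltonian

variable [Fintype V] [DecidableEq V]

theorem isHamiltonian_of_isPath {u v : V} (huv : G.Adj u v) (P : G.Walk v u) (hP : P.IsPath)
    (hmem : ∀ x, x ∈ P.support) (he : s(u, v) ∉ P.edges) : G.IsHamiltonian := by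
  intro _
  refine ⟨u, P.cons huv, ?_⟩
  rw [Walk.isHamiltonianCycle_iff_isCycle_and_support_count_tail_eq_one]
  refine ⟨(Walk.cons_isCycle_iff _ _).2 ⟨hP, he⟩, fun x => ?_⟩
  rw [Walk.support_cons, List.tail_cons]
  exact hP.isHamiltonian_of_mem hmem x

/-- A spanning cycle of a subgraph is a Hamiltonian cycle. -/
theorem IsCycles.isHamiltonian (hH : H.IsCycles) (hle : H ≤ G) {a a' : V} (h : H.Adj a a')
    (hreach : ∀ x, H.Reachable a x) : G.IsHamiltonian := by
  obtain ⟨c, hc, hsupp⟩ := hH.exists_cycle_toSubgraph_verts_eq_connectedComponentSupp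
    (c := H.connectedComponentMk a) (v := a) rfl ⟨a', h⟩
  refine IsHamiltonian.mono hle fun _ => ⟨a, c, ⟨hc, ?_⟩⟩
  refine hc.isPath_tail.isHamiltonian_of_mem fun x => ?_
  have hx : x ∈ c.support := by
    rw [← Walk.mem_verts_toSubgraph, hsupp, ConnectedComponent.mem_supp_iff,
      ConnectedComponent.eq]
    exact (hreach x).symm
  rw [← Walk.cons_support_tail hc.not_nil, List.mem_cons] at hx
  rcases hx with rfl | hx
  exacts [c.tail.end_mem_support, hx]

/-- Two cycles are merged by exchanging two edges. -/
theorem IsCycles.isHamiltonian_of_swap (hH : H.IsCycles) (hle : H ≤ G) {a a' b b' : V}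
    (haa' : H.Adj a a') (hbb' : H.Adj b b') (hab : G.Adj a b) (hab' : G.Adj a' b')
    (hnot : ¬ H.Reachable a b) (hreach : ∀ x, H.Reachable a x ∨ H.Reachable b x) :
    G.IsHamiltonian := by
  obtain ⟨P, hP, hPm⟩ := hH.exists_isPath haa'
  obtain ⟨Q, hQ, hQm⟩ := hH.exists_isPath hbb'
  have hdisj : ∀ x, x ∈ P.support → x ∈ Q.support → False := fun x h1 h2 =>
    hnot (((hPm x).1 h1).trans ((hQm x).1 h2).symm)
  -- The path runs along the first cycle from `a'` to `a`, crosses to `b`, and runs along the second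
  -- to `b'`; the edge `b'a'` closes it.
  let W : G.Walk a' b' := (P.mapLe hle).append (Walk.cons hab (Q.mapLe hle).reverse)
  have hW : W.support = P.support ++ Q.support.reverse := by
    simp [W, Walk.support_append]
  refine isHamiltonian_of_isPath hab'.symm W ?_ ?_ ?_
  · rw [Walk.isPath_def, hW, List.nodup_append']
    refine ⟨hP.support_nodup, List.nodup_reverse.2 hQ.support_nodup, fun x h1 h2 => ?_⟩
    exact hdisj x h1 (List.mem_reverse.1 h2)
  · intro x
    rw [hW, List.mem_append, List.mem_reverse, hPm, hQm]
    exact hreach x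
  · have ha' := P.start_mem_support
    have hb' := Q.start_mem_support
    have ha := P.end_mem_support
    have hb := Q.end_mem_support
    simp only [W, Walk.edges_append, Walk.edges_cons, Walk.edges_reverse, Walk.edges_mapLe_eq_edges,
      List.mem_append, List.mem_cons, List.mem_reverse, not_or]
    refine ⟨fun h => hdisj _ (P.fst_mem_support_of_mem_edges h) hb', fun h => ?_,
      fun h => hdisj _ ha' (Q.snd_mem_support_of_mem_edges h)⟩
    rcases Sym2.eq_iff.1 h with ⟨h1, -⟩ | ⟨-, h2⟩
    · exact hdisj _ ha (h1 ▸ hb')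
    · exact haa'.ne h2.symm

end Hamiltonian

end SimpleGraph

open SimpleGraph

/-! ### Triangle counts and rims of a locally linear graph. -/

namespace IsLocallyLinear

variable {V : Type*} {G : SimpleGraph V}

theorem link_closed (hG : IsLocallyLinear G) {v : V} {S : V → Prop} (hne : ∃ x, S x ∧ G.Adj v x)
    (hS : ∀ x y, S x → G.Adj v x → G.Adj v y → G.Adj x y → S y) (y : V) (hy : G.Adj v y) :
    S y := by
  obtain ⟨k, ⟨e⟩⟩ := hG.2 v
  have hconn : (G.induce (G.neighborSet v)).Connected := e.connected_iff.2 (pathGraph_connected k)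
  obtain ⟨x, hx, hvx⟩ := hne
  exact hconn.of_closed (S := fun z => S z) ⟨⟨x, hvx⟩, hx⟩
    (fun z w hz hzw => hS z w hz z.2 w.2 hzw) ⟨y, hy⟩

/-- If `u` were the only neighbour of `v`, then `v` would be isolated in the connected link of `u`,
hence all of it, and the graph would be a single edge. -/
theorem exists_two_neighbors [Fintype V] (hG : IsLocallyLinear G) (h3 : 3 ≤ Fintype.card V)
    (v : V) : ∃ x y, x ≠ y ∧ G.Adj v x ∧ G.Adj v y := by
  classical
  by_contra! hno
  obtain ⟨k, ⟨e⟩⟩ := hG.2 v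
  obtain ⟨u, hu⟩ := e.symm 0
  have hu : G.Adj v u := hu
  have hN : ∀ x, G.Adj v x → x = u := fun x hx => by
    by_contra hne
    exact hno x u hne hx hu
  have hN' : ∀ y, G.Adj u y → y = v := hG.link_closed (S := fun x => x = v) ⟨v, rfl, hu.symm⟩ (by
    rintro x y rfl - huy hxy
    exact absurd (hN y hxy) huy.ne')
  have hall := hG.1.of_closed (S := fun x => x = v ∨ x = u) ⟨v, .inl rfl⟩ (by
    rintro x y (rfl | rfl) hxy
    exacts [.inr (hN y hxy), .inl (hN' y hxy)])
  have : Fintype.card V ≤ 2 := by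
    rw [← Finset.card_univ]
    refine (Finset.card_le_card (t := {v, u}) fun x _ => ?_).trans Finset.card_le_two
    simpa using hall x
  omega

/-- The link of a vertex, as a path of length at least one. -/
theorem exists_link [Fintype V] (hG : IsLocallyLinear G) (h3 : 3 ≤ Fintype.card V) (v : V) :
    ∃ k, 1 ≤ k ∧ ∃ e : G.induce (G.neighborSet v) ≃g pathGraph (k + 1),
      ∀ x : G.neighborSet v, {y | G.Adj v y ∧ G.Adj x y}.ncard =
        if e x = 0 ∨ e x = Fin.last k then 1 else 2 := by
  obtain ⟨k, ⟨e⟩⟩ := hG.2 v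
  have hk : 1 ≤ k := by
    obtain ⟨x, y, hxy, hx, hy⟩ := hG.exists_two_neighbors h3 v
    have hne : e ⟨x, hx⟩ ≠ e ⟨y, hy⟩ := fun h => hxy (congrArg Subtype.val (e.injective h))
    by_contra hk
    exact hne (Fin.ext (by omega))
  refine ⟨k, hk, e, fun x => ?_⟩
  rw [← pathGraph_ncard_neighborSet hk]
  symm
  refine Set.BijOn.ncard_eq (f := fun i => (e.symm i : V)) ⟨?_, ?_, ?_⟩
  · intro i hi
    refine ⟨(e.symm i).2, ?_⟩
    have : (pathGraph (k + 1)).Adj (e x) (e (e.symm i)) := by simpa using hi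
    exact e.map_adj_iff.1 this
  · intro i _ j _ hij
    exact e.symm.injective (Subtype.ext hij)
  · rintro y ⟨hvy, hxy⟩
    refine ⟨e ⟨y, hvy⟩, ?_, by simp⟩
    exact e.map_adj_iff (v := x) (w := ⟨y, hvy⟩).2 hxy

/-- The triangles on `uv` are counted by the degree of `v` in the link of `u`, which is 1 or 2 on a
path. -/
theorem ncard_common [Fintype V] (hG : IsLocallyLinear G) (h3 : 3 ≤ Fintype.card V) {u v : V}
    (h : G.Adj u v) [Decidable (G.rimGraph.Adj u v)] :
    {x | G.Adj u x ∧ G.Adj v x}.ncard = if G.rimGraph.Adj u v then 1 else 2 := by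
  obtain ⟨k, -, e, he⟩ := hG.exists_link h3 u
  have := he ⟨v, h⟩
  split_ifs with hrim
  · exact hrim.2
  · split_ifs at this
    · exact absurd ⟨h, this⟩ hrim
    · exact this

/-- The rim neighbours of `v` are the two ends of its link, distinct because the link has at least
two vertices. -/
theorem ncard_neighborSet_rimGraph [Fintype V] (hG : IsLocallyLinear G)
    (h3 : 3 ≤ Fintype.card V) (v : V) : (G.rimGraph.neighborSet v).ncard = 2 := by
  obtain ⟨k, hk, e, he⟩ := hG.exists_link h3 v
  have hpair : ({0, Fin.last k} : Set (Fin (k + 1))).ncard = 2 :=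
    Set.ncard_pair (by simp only [ne_eq, Fin.ext_iff, Fin.val_zero, Fin.val_last]; omega)
  rw [← hpair]
  symm
  refine Set.BijOn.ncard_eq (f := fun i => (e.symm i : V)) ⟨?_, ?_, ?_⟩
  · intro i hi
    refine ⟨(e.symm i).2, ?_⟩
    rw [he (e.symm i), RelIso.apply_symm_apply, if_pos (by simpa using hi)]
  · intro i _ j _ hij
    exact e.symm.injective (Subtype.ext hij)
  · rintro y ⟨hvy, hy⟩
    refine ⟨e ⟨y, hvy⟩, ?_, by simp⟩
    have := he ⟨y, hvy⟩
    by_contra hne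
    rw [if_neg (by simpa using hne)] at this
    simp only at this
    omega

theorem isCycles_rimGraph [Fintype V] (hG : IsLocallyLinear G) (h3 : 3 ≤ Fintype.card V) :
    G.rimGraph.IsCycles := fun v _ => hG.ncard_neighborSet_rimGraph h3 v

/-- A triangle of rim edges is the whole graph. -/
theorem eq_of_rim_triangle (hG : IsLocallyLinear G) {x y z : V} (hxy : G.rimGraph.Adj x y)
    (hyz : G.rimGraph.Adj y z) (hzx : G.rimGraph.Adj z x) (v : V) : v = x ∨ v = y ∨ v = z := by
  -- The rim edges `xy` and `xz` lie in no triangle but `xyz`, so `{y, z}` is a component of the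
  -- link of `x`, hence the whole link.
  have key : ∀ {x y z : V}, G.rimGraph.Adj x y → G.rimGraph.Adj y z → G.rimGraph.Adj z x →
      ∀ w, G.Adj x w → w = y ∨ w = z := by
    intro x y z hxy hyz hzx
    have hunique : ∀ {a b c w : V}, G.rimGraph.Adj a b → G.rimGraph.Adj b c →
        G.rimGraph.Adj c a → G.Adj a w → G.Adj b w → w = c := by
      intro a b c w hab hbc hca haw hbw
      obtain ⟨d, hd⟩ := Set.ncard_eq_one.1 hab.2
      have hw : w ∈ {x | G.Adj a x ∧ G.Adj b x} := ⟨haw, hbw⟩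
      have hc : c ∈ {x | G.Adj a x ∧ G.Adj b x} := ⟨hca.1.symm, hbc.1⟩
      rw [hd] at hw hc
      exact hw.trans hc.symm
    refine hG.link_closed (S := fun w => w = y ∨ w = z) ⟨y, .inl rfl, hxy.1⟩ ?_
    rintro a b (rfl | rfl) hxa hxb hab
    · exact .inr (hunique hxy hyz hzx hxb hab)
    · exact .inl (hunique hzx.symm hyz.symm hxy.symm hxb hab)
  refine hG.1.of_closed (S := fun v => v = x ∨ v = y ∨ v = z) ⟨x, .inl rfl⟩ ?_ v
  rintro a b (rfl | rfl | rfl) hab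
  · exact .inr (key hxy hyz hzx b hab)
  · have := key hyz hzx hxy b hab; tauto
  · have := key hzx hxy hyz b hab; tauto

end IsLocallyLinear

/-! ### Cyclic labellings of the rims. -/

namespace SimpleGraph

variable {V : Type*} {G H : SimpleGraph V}

/-- A component of a disjoint union of cycles, labelled cyclically from `a`. -/
theorem IsCycles.exists_labelling [Finite V] (hH : H.IsCycles) {a a' : V} (h : H.Adj a a') :
    ∃ (m : ℕ) (c : ℕ → V), 3 ≤ m ∧ c 0 = a ∧ (∀ i < m, ∀ j < m, c i = c j → i = j) ∧
      (∀ x, H.Reachable a x ↔ ∃ i < m, c i = x) ∧ ∀ i < m, H.Adj (c i) (c ((i + 1) % m)) := by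
  obtain ⟨c, hc, hsupp⟩ := hH.exists_cycle_toSubgraph_verts_eq_connectedComponentSupp
    (c := H.connectedComponentMk a) (v := a) rfl ⟨a', h⟩
  have h3 := hc.three_le_length
  refine ⟨c.length, c.getVert, h3, c.getVert_zero, ?_, ?_, ?_⟩
  · exact fun i hi j hj hij => hc.getVert_injOn' (show i ≤ c.length - 1 by omega)
      (show j ≤ c.length - 1 by omega) hij
  · intro x
    have : H.Reachable a x ↔ x ∈ c.support := by
      rw [← Walk.mem_verts_toSubgraph, hsupp, ConnectedComponent.mem_supp_iff,
        ConnectedComponent.eq]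
      exact ⟨Reachable.symm, Reachable.symm⟩
    rw [this, Walk.mem_support_iff_exists_getVert]
    constructor
    · rintro ⟨i, hi, hi'⟩
      rcases hi'.lt_or_eq with hi' | rfl
      · exact ⟨i, hi', hi⟩
      · exact ⟨0, by omega, by rw [← hi, c.getVert_zero, c.getVert_length]⟩
    · rintro ⟨i, hi, hi'⟩
      exact ⟨i, hi', hi.le⟩
  · intro i hi
    have := c.adj_getVert_succ hi
    rcases (Nat.succ_le_of_lt hi).lt_or_eq with hi' | hi'
    · rwa [Nat.mod_eq_of_lt hi']
    · rw [← Nat.succ_eq_add_one, hi', Nat.mod_self, c.getVert_zero]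
      rwa [← Nat.succ_eq_add_one, hi', c.getVert_length] at this

end SimpleGraph

namespace TwoRims

/-- On a cycle of length at least 3, two steps forward never return to the start. -/
theorem next_ne_prev {p q i : ℕ} (hp : 3 ≤ p) (hq : 3 ≤ q) (hi : i < p + q) :
    next p q i ≠ prev p q i := by
  intro h
  have h' := next_prev hi
  rw [← h] at h'
  rcases lt_or_ge i p with hip | hip
  · rw [next_of_lt hip, next_of_lt (Nat.mod_lt _ (by omega)), Nat.mod_add_mod] at h'
    rcases lt_or_ge (i + 1 + 1) p with h1 | h1
    · rw [Nat.mod_eq_of_lt h1] at h'; omega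
    · rw [Nat.mod_eq_sub_mod h1, Nat.mod_eq_of_lt (by omega)] at h'; omega
  · rw [next_of_le hip, next_of_le (by omega), Nat.add_sub_cancel_left, Nat.mod_add_mod] at h'
    rcases lt_or_ge (i - p + 1 + 1) q with h1 | h1
    · rw [Nat.mod_eq_of_lt h1] at h'; omega
    · rw [Nat.mod_eq_sub_mod h1, Nat.mod_eq_of_lt (by omega)] at h'; omega

theorem next_lt {p q i : ℕ} (hi : i < p + q) : next p q i < p + q := by
  rcases lt_or_ge i p with hip | hip
  · rw [next_of_lt hip]; have := Nat.mod_lt (i + 1) (show 0 < p by omega); omega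
  · rw [next_of_le hip]; have := Nat.mod_lt (i - p + 1) (show 0 < q by omega); omega

theorem prev_lt {p q i : ℕ} (hi : i < p + q) : prev p q i < p + q := by
  by_contra h
  have h' := next_prev hi
  rcases lt_or_ge (prev p q i) p with hip | hip
  · omega
  · have h1 : prev p q i = if i < p then (i + (p - 1)) % p else p + (i - p + (q - 1)) % q := by
      split_ifs with hi'
      · have : Nat.ble p i = false := by rw [← Bool.not_eq_true, Nat.ble_eq]; omega
        rw [prev, this]; rfl
      · have : Nat.ble p i = true := by rw [Nat.ble_eq]; omega
        rw [prev, this]; rfl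
    split_ifs at h1 with hi'
    · have := Nat.mod_lt (i + (p - 1)) (show 0 < p by omega); omega
    · have := Nat.mod_lt (i - p + (q - 1)) (show 0 < q by omega); omega

end TwoRims

/-! ### The lower bound: from rims to the search. -/

namespace IsLocallyLinear

variable {V : Type*} {G : SimpleGraph V}

open TwoRims

theorem four_le_of_labelling (hG : IsLocallyLinear G) {m : ℕ} {c : ℕ → V} (hm : 3 ≤ m)
    (hc : ∀ i < m, G.rimGraph.Adj (c i) (c ((i + 1) % m))) {b : V}
    (hb : ¬ ∃ i < m, c i = b) : 4 ≤ m := by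
  by_contra hm'
  obtain rfl : m = 3 := by omega
  rcases hG.eq_of_rim_triangle (hc 0 (by omega)) (hc 1 (by omega)) (hc 2 (by omega)) b with
    h | h | h
  exacts [hb ⟨0, by omega, h.symm⟩, hb ⟨1, by omega, h.symm⟩, hb ⟨2, by omega, h.symm⟩]

variable [Fintype V]

/-- In a cyclically labelled locally linear graph with two rims, `rim` describes the rim edges. -/
theorem rim_iff_rimGraph_adj (hG : IsLocallyLinear G) (h3 : 3 ≤ Fintype.card V) {p q : ℕ}
    (hp : 3 ≤ p) (hq : 3 ≤ q) {f : ℕ → V} (hinj : ∀ i < p + q, ∀ j < p + q, f i = f j → i = j)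
    (hadj : ∀ i < p + q, G.rimGraph.Adj (f i) (f (next p q i))) {i j : ℕ} (hi : i < p + q)
    (hj : j < p + q) : rim p q i j = true ↔ G.rimGraph.Adj (f i) (f j) := by
  have hprev : G.rimGraph.Adj (f i) (f (prev p q i)) := by
    have := hadj _ (prev_lt hi)
    rw [next_prev hi] at this
    exact this.symm
  constructor
  · intro h
    rcases rim_iff.1 h with rfl | rfl
    exacts [hadj i hi, (hadj j hj).symm]
  · intro h
    have hne : f (next p q i) ≠ f (prev p q i) := fun h =>
      next_ne_prev hp hq hi (hinj _ (next_lt hi) _ (prev_lt hi) h)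
    have hsub : {f (next p q i), f (prev p q i)} ⊆ G.rimGraph.neighborSet (f i) := by
      rintro x (rfl | rfl)
      exacts [hadj i hi, hprev]
    have heq := Set.eq_of_subset_of_ncard_le hsub
      (by rw [hG.ncard_neighborSet_rimGraph h3, Set.ncard_pair hne])
    have hmem : f j ∈ G.rimGraph.neighborSet (f i) := h
    rw [← heq] at hmem
    rcases hmem with hmem | hmem
    · rw [hinj _ hj _ (next_lt hi) hmem]; exact rim_next p q i
    · rw [hinj _ hj _ (prev_lt hi) hmem]; exact rim_prev hi

/-- All properties are transported along the labelling `f`. Nonhamiltonicity enters only in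
`noSwap`, since an exchange would merge the rims. -/
theorem unmergeable [DecidableEq V] (hG : IsLocallyLinear G) (hham : ¬ G.IsHamiltonian)
    {p q : ℕ} (hp : 3 ≤ p) (hq : 3 ≤ q) {f : ℕ → V}
    (hinj : ∀ i < p + q, ∀ j < p + q, f i = f j → i = j) (hsurj : ∀ x, ∃ i < p + q, f i = x)
    (hadj : ∀ i < p + q, G.rimGraph.Adj (f i) (f (next p q i)))
    (hnot : ¬ G.rimGraph.Reachable (f 0) (f p))
    (hA : ∀ i < p, G.rimGraph.Reachable (f 0) (f i))
    (hB : ∀ i, p ≤ i → i < p + q → G.rimGraph.Reachable (f p) (f i)) :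
    Unmergeable p q fun i j => i < p + q ∧ j < p + q ∧ G.Adj (f i) (f j) := by
  classical
  have h3 : 3 ≤ Fintype.card V := by
    rw [← Fintype.card_fin 3]
    refine Fintype.card_le_of_injective (fun i : Fin 3 => f i) fun i j hij => Fin.ext ?_
    exact hinj _ (by omega) _ (by omega) hij
  constructor
  case symm => exact fun h => ⟨h.2.1, h.1, h.2.2.symm⟩
  case irrefl => exact fun h => h.2.2.ne rfl
  case lt => exact fun h => h.2.1
  case card_common =>
    rintro u v ⟨hu, hv, huv⟩
    have hcap : cap p q u v = if G.rimGraph.Adj (f u) (f v) then 1 else 2 := by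
      rw [← hG.rim_iff_rimGraph_adj h3 hp hq hinj hadj hu hv, cap]
      cases rim p q u v <;> simp
    rw [hcap, ← hG.ncard_common h3 huv]
    refine Set.BijOn.ncard_eq (f := f) ⟨?_, ?_, ?_⟩
    · exact fun x hx => ⟨hx.1.2.2, hx.2.2.2⟩
    · exact fun x hx y hy hxy => hinj _ hx.1.2.1 _ hy.1.2.1 hxy
    · rintro y ⟨huy, hvy⟩
      obtain ⟨x, hx, rfl⟩ := hsurj y
      exact ⟨x, ⟨⟨hu, hx, huy⟩, hv, hx, hvy⟩, rfl⟩
  case link =>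
    rintro v S ⟨x, hSx, hv, hx, hvx⟩ hS y ⟨-, hy, hvy⟩
    obtain ⟨z, hz, hzy, hSz⟩ := hG.link_closed (v := f v)
      (S := fun y => ∃ x < p + q, f x = y ∧ S x) ⟨f x, ⟨x, hx, rfl, hSx⟩, hvx⟩ (by
        rintro _ y ⟨x, hx, rfl, hSx⟩ hvx hvy hxy
        obtain ⟨y, hy, rfl⟩ := hsurj y
        exact ⟨y, hy, rfl, hS x y hSx ⟨hv, hx, hvx⟩ ⟨hv, hy, hvy⟩ ⟨hx, hy, hxy⟩⟩) (f y) hvy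
    rwa [← hinj z hz y hy hzy]
  case noSwap =>
    rintro a b a' b' ha hb ⟨ha', hb', hab⟩ haa' hbb' ⟨ha'', hb'', hab'⟩
    refine hham ((hG.isCycles_rimGraph h3).isHamiltonian_of_swap rimGraph_le
      ((hG.rim_iff_rimGraph_adj h3 hp hq hinj hadj ha' ha'').1 haa')
      ((hG.rim_iff_rimGraph_adj h3 hp hq hinj hadj hb' hb'').1 hbb') hab hab' ?_ ?_)
    · exact fun h => hnot (((hA a ha).trans h).trans (hB b hb hb').symm)
    · intro x
      obtain ⟨i, hi, rfl⟩ := hsurj x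
      rcases lt_or_ge i p with hip | hip
      · exact .inl ((hA a ha).symm.trans (hA i hip))
      · exact .inr ((hB b hb hb').symm.trans (hB i hip hi))

/-- A nonhamiltonian locally linear graph with exactly two rims has order at least twelve. -/
theorem twelve_le_of_two_rims [DecidableEq V] (hG : IsLocallyLinear G)
    (hham : ¬ G.IsHamiltonian) {p q : ℕ} (hq : 4 ≤ q) (hqp : q ≤ p) {c d : ℕ → V}
    (hcinj : ∀ i < p, ∀ j < p, c i = c j → i = j)
    (hdinj : ∀ i < q, ∀ j < q, d i = d j → i = j)
    (hcadj : ∀ i < p, G.rimGraph.Adj (c i) (c ((i + 1) % p)))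
    (hdadj : ∀ i < q, G.rimGraph.Adj (d i) (d ((i + 1) % q)))
    (hc : ∀ x, G.rimGraph.Reachable (c 0) x ↔ ∃ i < p, c i = x)
    (hd : ∀ x, G.rimGraph.Reachable (d 0) x ↔ ∃ i < q, d i = x)
    (hadj : G.Adj (c 0) (d 0)) (hnot : ¬ G.rimGraph.Reachable (c 0) (d 0))
    (hreach : ∀ x, G.rimGraph.Reachable (c 0) x ∨ G.rimGraph.Reachable (d 0) x) :
    12 ≤ p + q := by
  by_contra hlt
  let f : ℕ → V := fun i => if i < p then c i else d (i - p)
  have hfc : ∀ i, i < p → f i = c i := fun i hi => if_pos hi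
  have hfd : ∀ i, p ≤ i → f i = d (i - p) := fun i hi => if_neg hi.not_gt
  have hA : ∀ i < p, G.rimGraph.Reachable (c 0) (f i) := fun i hi =>
    (hc _).2 ⟨i, hi, (hfc i hi).symm⟩
  have hB : ∀ i, p ≤ i → i < p + q → G.rimGraph.Reachable (d 0) (f i) := fun i hi hi' =>
    (hd _).2 ⟨i - p, by omega, (hfd i hi).symm⟩
  have h0 : f 0 = c 0 := hfc 0 (by omega)
  have hp0 : f p = d 0 := by rw [hfd p le_rfl, Nat.sub_self]
  have hinj : ∀ i < p + q, ∀ j < p + q, f i = f j → i = j := by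
    intro i hi j hj hij
    rcases lt_or_ge i p with hip | hip <;> rcases lt_or_ge j p with hjp | hjp
    · rw [hfc i hip, hfc j hjp] at hij
      exact hcinj i hip j hjp hij
    · exact absurd ((hA i hip).trans (hij ▸ (hB j hjp hj).symm)) hnot
    · exact absurd ((hA j hjp).trans (hij ▸ (hB i hip hi).symm)) hnot
    · rw [hfd i hip, hfd j hjp] at hij
      have := hdinj _ (by omega) _ (by omega) hij
      omega
  have hsurj : ∀ x, ∃ i < p + q, f i = x := by
    intro x
    rcases hreach x with h | h
    · obtain ⟨i, hi, rfl⟩ := (hc x).1 h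
      exact ⟨i, by omega, hfc i hi⟩
    · obtain ⟨i, hi, rfl⟩ := (hd x).1 h
      exact ⟨p + i, by omega, by rw [hfd _ (by omega), Nat.add_sub_cancel_left]⟩
  have hfadj : ∀ i < p + q, G.rimGraph.Adj (f i) (f (next p q i)) := by
    intro i hi
    rcases lt_or_ge i p with hip | hip
    · rw [next_of_lt hip, hfc i hip, hfc _ (Nat.mod_lt _ (by omega))]
      exact hcadj i hip
    · rw [next_of_le hip, hfd i hip, hfd _ (by omega), Nat.add_sub_cancel_left]
      exact hdadj _ (by omega)
  have hU := hG.unmergeable hham (p := p) (q := q) (by omega) (by omega) hinj hsurj hfadj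
    (by rwa [h0, hp0]) (by rwa [h0]) (by rwa [hp0])
  exact hU.false_of_le (fun i hi => ⟨hi, next_lt hi, (hfadj i hi).1⟩)
    ⟨by omega, by omega, by rwa [h0, hp0]⟩ hq hqp (by omega)

theorem twelve_le_card [DecidableEq V] (hG : IsLocallyLinear G) (h3 : 3 ≤ Fintype.card V)
    (hham : ¬ G.IsHamiltonian) : 12 ≤ Fintype.card V := by
  have hcyc := hG.isCycles_rimGraph h3
  have hnbr : ∀ v, ∃ w, G.rimGraph.Adj v w := fun v =>
    Set.nonempty_of_ncard_ne_zero (s := G.rimGraph.neighborSet v)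
      (by rw [hG.ncard_neighborSet_rimGraph h3]; norm_num)
  have hpart : ∀ v, ∃ w, ¬ G.rimGraph.Reachable v w := by
    intro v
    by_contra! hall
    obtain ⟨w, hw⟩ := hnbr v
    exact hham (hcyc.isHamiltonian rimGraph_le hw hall)
  have hfour : ∀ {v m} {c : ℕ → V}, 3 ≤ m → (∀ x, G.rimGraph.Reachable v x ↔ ∃ i < m, c i = x) →
      (∀ i < m, G.rimGraph.Adj (c i) (c ((i + 1) % m))) → 4 ≤ m := by
    intro v m c hm hreach hc
    obtain ⟨b, hb⟩ := hpart v
    rw [hreach] at hb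
    exact hG.four_le_of_labelling hm hc hb
  have hcard : ∀ {v m} {c : ℕ → V}, (∀ i < m, ∀ j < m, c i = c j → i = j) →
      (∀ x, G.rimGraph.Reachable v x ↔ ∃ i < m, c i = x) →
      {x | G.rimGraph.Reachable v x}.ncard = m := by
    intro v m c hinj hreach
    have : {i | i < m}.ncard = m := by
      rw [show {i | i < m} = ((Finset.range m : Finset ℕ) : Set ℕ) by ext; simp,
        Set.ncard_coe_finset, Finset.card_range]
    conv_rhs => rw [← this]
    symm
    refine Set.BijOn.ncard_eq (f := c) ⟨?_, ?_, ?_⟩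
    · exact fun i hi => (hreach _).2 ⟨i, hi, rfl⟩
    · exact fun i hi j hj hij => hinj i hi j hj hij
    · exact fun x hx => (hreach x).1 hx
  have hdisj : ∀ {v w}, ¬ G.rimGraph.Reachable v w →
      Disjoint {x | G.rimGraph.Reachable v x} {x | G.rimGraph.Reachable w x} := fun hvw =>
    Set.disjoint_left.2 fun x h1 h2 => hvw (Reachable.trans h1 (Reachable.symm h2))
  -- If no edge joined different rims, a rim would be closed under adjacency and fill the connected
  -- graph.
  obtain ⟨a, b, hab, hnot⟩ : ∃ a b, G.Adj a b ∧ ¬ G.rimGraph.Reachable a b := by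
    obtain ⟨v⟩ := hG.1.nonempty
    obtain ⟨w, hw⟩ := hpart v
    by_contra! hall
    exact hw (hG.1.of_closed (S := G.rimGraph.Reachable v) ⟨v, .refl v⟩
      (fun x y hx hxy => hx.trans (hall x y hxy)) w)
  obtain ⟨a', ha'⟩ := hnbr a
  obtain ⟨b', hb'⟩ := hnbr b
  obtain ⟨p, c, hp, rfl, hcinj, hc, hcadj⟩ := hcyc.exists_labelling ha'
  obtain ⟨q, d, hq, rfl, hdinj, hd, hdadj⟩ := hcyc.exists_labelling hb'
  have hp4 := hfour hp hc hcadj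
  have hq4 := hfour hq hd hdadj
  have hunion : ({x | G.rimGraph.Reachable (c 0) x} ∪
      {x | G.rimGraph.Reachable (d 0) x}).ncard = p + q := by
    rw [Set.ncard_union_eq (hdisj hnot), hcard hcinj hc, hcard hdinj hd]
  by_cases hreach : ∀ x, G.rimGraph.Reachable (c 0) x ∨ G.rimGraph.Reachable (d 0) x
  · have hle : p + q ≤ Fintype.card V := by
      rw [← hunion, ← Nat.card_eq_fintype_card, ← Set.ncard_univ]
      exact Set.ncard_le_ncard (Set.subset_univ _)
    refine le_trans ?_ hle
    rcases le_total q p with hqp | hpq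
    · exact hG.twelve_le_of_two_rims hham hq4 hqp hcinj hdinj hcadj hdadj hc hd hab hnot hreach
    · rw [add_comm]
      exact hG.twelve_le_of_two_rims hham hp4 hpq hdinj hcinj hdadj hcadj hd hc hab.symm
        (fun h => hnot h.symm) (fun x => (hreach x).symm)
  -- A vertex `e` outside both rims lies on a third one, and 4 + 4 + 4 = 12.
  · push Not at hreach
    obtain ⟨e, hce, hde⟩ := hreach
    obtain ⟨e', he'⟩ := hnbr e
    obtain ⟨r, g, hr, rfl, hginj, hg, hgadj⟩ := hcyc.exists_labelling he'
    have hr4 := hfour hr hg hgadj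
    have hunion' := Set.ncard_union_eq
      (Set.disjoint_union_left.2 ⟨hdisj hce, hdisj hde⟩)
    rw [hunion, hcard hginj hg] at hunion'
    have hle := Set.ncard_le_ncard (Set.subset_univ ({x | G.rimGraph.Reachable (c 0) x} ∪
      {x | G.rimGraph.Reachable (d 0) x} ∪ {x | G.rimGraph.Reachable (g 0) x}))
    rw [Set.ncard_univ, Nat.card_eq_fintype_card, hunion'] at hle
    omega

end IsLocallyLinear

/-! ### The extremal graph of order 12. -/

/-- The square antiprism `0, 1, 2, 3` (inner square), `4, 5, 6, 7` (outer square) without its two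
square faces, with an ear attached to each of the four edges of the outer square. -/
def earedAntiprism : SimpleGraph (Fin 12) :=
  SimpleGraph.fromRel fun a b =>
    a.val < 4 ∧ (b.val = (a + 1) % 4 ∨ b.val = a + 4 ∨ b.val = (a + 1) % 4 + 4) ∨
    -- For `a = 4 + i` the last two values are ears `i` and `i - 1` modulo 4, so ear `i` sits on the
    -- outer edge from `i` to `i + 1`.
    4 ≤ a.val ∧ a.val < 8 ∧ (b.val = (a + 1) % 4 + 4 ∨ b.val = a + 4 ∨ b.val = (a + 3) % 4 + 8)

namespace earedAntiprism

instance : DecidableRel earedAntiprism.Adj := fun a b =>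
  inferInstanceAs (Decidable (a ≠ b ∧ _))

/-- Vertex `i` of square `j`, where the ears form the third square. -/
def vertex (j : Fin 3) (i : Fin 4) : Fin 12 := ⟨4 * j + i, by omega⟩

theorem isPathGraph_induce {V : Type*} {G : SimpleGraph V} {s : Set V} {k : ℕ}
    (g : Fin (k + 1) → V) (hinj : Function.Injective g) (hs : ∀ x, x ∈ s ↔ ∃ i, g i = x)
    (hadj : ∀ i j, G.Adj (g i) (g j) ↔ i.val + 1 = j.val ∨ j.val + 1 = i.val) :
    IsPathGraph (G.induce s) := by
  have hbij : Function.Bijective fun i => (⟨g i, (hs _).2 ⟨i, rfl⟩⟩ : s) :=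
    ⟨fun i j hij => hinj (congrArg Subtype.val hij), fun ⟨x, hx⟩ => by
      obtain ⟨i, rfl⟩ := (hs x).1 hx
      exact ⟨i, rfl⟩⟩
  refine ⟨k, ⟨RelIso.symm ⟨Equiv.ofBijective _ hbij, ?_⟩⟩⟩
  intro i j
  rw [pathGraph_adj]
  exact hadj i j

/-- By rotational symmetry one list, with `i` modulo 4, gives in path order the link of every vertex
of a square. -/
theorem isPathGraph_link (v : Fin 12) :
    IsPathGraph (earedAntiprism.induce (earedAntiprism.neighborSet v)) := by
  obtain ⟨i, rfl | rfl | rfl⟩ : ∃ i, v = vertex 0 i ∨ v = vertex 1 i ∨ v = vertex 2 i := by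
    revert v; decide
  · refine isPathGraph_induce ![vertex 0 (i - 1), vertex 1 i, vertex 1 (i + 1), vertex 0 (i + 1)]
      ?_ ?_ ?_
    · revert i; decide
    · simp only [mem_neighborSet]; revert i; decide
    · revert i; decide
  · refine isPathGraph_induce ![vertex 2 (i - 1), vertex 1 (i - 1), vertex 0 (i - 1), vertex 0 i,
      vertex 1 (i + 1), vertex 2 i] ?_ ?_ ?_
    · revert i; decide
    · simp only [mem_neighborSet]; revert i; decide
    · revert i; decide
  · refine isPathGraph_induce ![vertex 1 i, vertex 1 (i + 1)] ?_ ?_ ?_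
    · revert i; decide
    · simp only [mem_neighborSet]; revert i; decide
    · revert i; decide

/-- Every vertex other than 0 has a smaller neighbour. -/
theorem connected : earedAntiprism.Connected := by
  rw [connected_iff_exists_forall_reachable]
  refine ⟨0, fun v => ?_⟩
  induction v using WellFoundedLT.induction with
  | ind v ih =>
    by_cases hv : v = 0
    · rw [hv]
    · obtain ⟨w, hw, hwv⟩ : ∃ w < v, earedAntiprism.Adj w v := by
        revert v; decide
      exact (ih w hw).trans hwv.reachable

theorem isLocallyLinear : IsLocallyLinear earedAntiprism := ⟨connected, isPathGraph_link⟩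

/-- Every ear is followed by a vertex of the outer square on a Hamiltonian cycle, so that the cycle
cannot leave the inner square. -/
theorem not_isHamiltonian : ¬ earedAntiprism.IsHamiltonian := by
  intro h
  obtain ⟨p, hp⟩ := h.exists_isHamiltonianCycle 0
  have hlen : p.length = 12 := by simpa using hp.length_eq
  have hstep : ∀ i < 12, earedAntiprism.Adj (p.getVert i) (p.getVert (i + 1)) := fun i hi =>
    p.adj_getVert_succ (by omega)
  have hear : ∀ a b, earedAntiprism.Adj a b → 8 ≤ a → 4 ≤ b ∧ b < 8 := by decide
  have hinner : ∀ a b, earedAntiprism.Adj a b → a < 4 → b < 8 := by decide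
  have hsurj : ∀ v, ∃ i < 12, p.getVert i = v := by
    intro v
    obtain ⟨i, hi, hi'⟩ := Walk.mem_support_iff_exists_getVert.1 (hp.mem_support v)
    rcases hi'.lt_or_eq with hi' | rfl
    · exact ⟨i, by omega, hi⟩
    · exact ⟨0, by omega, by rw [← hi, p.getVert_zero, p.getVert_length]⟩
  -- `T` collects the steps that end in the outer square and `S` those that start at an ear. Since
  -- `S ⊆ T` and |T| ≤ 4 ≤ |S|, the outer square is entered only from ears.
  let T := (Finset.range 12).filter fun i => 4 ≤ p.getVert (i + 1) ∧ p.getVert (i + 1) < 8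
  let S := (Finset.range 12).filter fun i => 8 ≤ p.getVert i
  have hT : T.card ≤ 4 := by
    refine (Finset.card_le_card_of_injOn (t := Finset.univ.filter fun v : Fin 12 => 4 ≤ v ∧ v < 8)
      (fun i => p.getVert (i + 1)) (fun i hi => ?_) fun i hi j hj hij => ?_).trans (by decide)
    · simpa using (Finset.mem_filter.1 hi).2
    · have hi := Finset.mem_range.1 (Finset.mem_filter.1 hi).1
      have hj := Finset.mem_range.1 (Finset.mem_filter.1 hj).1
      have := hp.isCycle.getVert_injOn (show 1 ≤ i + 1 ∧ i + 1 ≤ p.length by omega)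
        (show 1 ≤ j + 1 ∧ j + 1 ≤ p.length by omega) hij
      omega
  have hS : 4 ≤ S.card := by
    refine le_trans (b := (Finset.univ.filter fun v : Fin 12 => 8 ≤ v).card) (by decide)
      (Finset.card_le_card_of_surjOn p.getVert fun v hv => ?_)
    obtain ⟨i, hi, rfl⟩ := hsurj v
    exact ⟨i, Finset.mem_filter.2 ⟨Finset.mem_range.2 hi, by simpa using hv⟩, rfl⟩
  have hST : S ⊆ T := by
    intro i hi
    obtain ⟨hi, hi'⟩ := Finset.mem_filter.1 hi
    exact Finset.mem_filter.2 ⟨hi, hear _ _ (hstep i (Finset.mem_range.1 hi)) hi'⟩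
  have heq : S = T := Finset.eq_of_subset_of_card_le hST (hT.trans hS)
  -- The cycle starts at the inner vertex 0. Leaving the inner square means stepping into the outer
  -- one, and such a step would have to start at an ear.
  have hall : ∀ i < 12, p.getVert i < 4 := by
    intro i
    induction i with
    | zero => intro _; rw [p.getVert_zero]; decide
    | succ i ih =>
      intro hi
      have hi4 := ih (by omega)
      have h8 := hinner _ _ (hstep i (by omega)) hi4
      by_contra hge
      have : i ∈ S := heq ▸ Finset.mem_filter.2
        ⟨Finset.mem_range.2 (by omega), not_lt.1 hge, h8⟩
      have := (Finset.mem_filter.1 this).2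
      omega
  obtain ⟨i, hi, hi'⟩ := hsurj 8
  have := hall i hi
  rw [hi'] at this
  exact absurd this (by decide)

end earedAntiprism

theorem theorem1 :
    IsLeast {n : ℕ | 3 ≤ n ∧
      ∃ G : SimpleGraph (Fin n), IsLocallyLinear G ∧ ¬ G.IsHamiltonian} 12 := by
  refine ⟨⟨by norm_num, earedAntiprism, earedAntiprism.isLocallyLinear,
    earedAntiprism.not_isHamiltonian⟩, ?_⟩
  rintro n ⟨h3, G, hG, hham⟩
  simpa using hG.twelve_le_card (by simpa using h3) hham
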